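/- Let $(F,\rho)$ be a non-empty compact metric space. A \emph{choice of abstract rationals} in $F$ is a family $P=(P(q))_{q\ge 1}$ where, for every integer $q\ge 1$, $P(q)\subseteq F$ is a maximal $(1/q)$-separated set ($\rho(p_1,p_2)\ge 1/q$ for distinct $p_1,p_2\in P(q)$, and $P(q)$ is maximal under inclusion with this property). For $t>0$ put $$F_t=\bigcap_{N}\bigcup_{q>N}\bigcup_{p\in P(q)}B(p,q^{-t}),$$ where $B(x,r)$ is the closed ball in $F$. The space $F$ is $s$-Ahlfors–David regular if there is $C>0$ with $r^s/C\le\mathcal H^s(B(x,r))\le Cr^s$ for all $x\in F$ and $0<r<1$, where $\mathcal H^s$ is $s$-dimensional Hausdorff measure. For such $F$ let $$d(P)=\sup\{d>0:\ \mathcal H^s(B\setminus F_d)=0\text{ for some ball }B=B(x,r)\subseteq F,\ r>0\},$$ $$\sigma(F)=\{d(P): P\text{ a choice of abstract rationals in }F\}$$ be the Dirichlet exponent of $P$ and the Dirichlet spectrum of $F$. \textbf{Proposition.} The interval $F=[0,1]$ with the Euclidean distance is $1$-Ahlfors–David regular, and $\sigma(F)=[1,2]$. Moreover, for every $d\in\sigma(F)$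 there is a choice $P$ of abstract rationals in $F$ with $d(P)=d$ such that $$\dim_{\mathrm H}F_t=\frac{d(P)}{t}\qquad\text{for all } t\ge d(P).$$ -/

import Mathlib

open MeasureTheory Set

section AbstractRationals

/-- A subset `S` of a metric space is `δ`-separated: distinct points are at distance at
least `δ` (non-strict inequality). -/
def IsSep {X : Type*} [MetricSpace X] (δ : ℝ) (S : Set X) : Prop :=
  S.Pairwise fun x y => δ ≤ dist x y

/-- `P` is a choice of abstract rationals in the metric space `X`: for every level `q ≥ 1`,
`P q` is an (inclusion-)maximal `1/q`-separated subset. The value `P 0` plays no role. -/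
def IsAbstractRationals {X : Type*} [MetricSpace X] (P : ℕ → Set X) : Prop :=
  ∀ q : ℕ, 1 ≤ q → Maximal (IsSep (1 / (q : ℝ))) (P q)

/-- The set `F_t = ⋂_N ⋃_{q > N} ⋃_{p ∈ P(q)} B(p, 1/q^t)` (closed balls) of points which are
`t`-approximable by `P`. -/
def approxSet {X : Type*} [MetricSpace X] (P : ℕ → Set X) (t : ℝ) : Set X :=
  ⋂ N : ℕ, ⋃ q : ℕ, ⋃ _ : N < q, ⋃ p ∈ P q, Metric.closedBall p (1 / (q : ℝ) ^ t)

/-- A compact metric space is `s`-Ahlfors–David regular if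
`r^s / C ≤ ℋ^s(B(x,r)) ≤ C r^s` for all points `x` and all `0 < r < 1`. -/
def IsAhlforsDavidRegular (X : Type*) [MetricSpace X] [MeasurableSpace X] [BorelSpace X]
    (s : ℝ) : Prop :=
  CompactSpace X ∧ 0 ≤ s ∧ ∃ C : ℝ, 0 < C ∧ ∀ (x : X) (r : ℝ), 0 < r → r < 1 →
    ENNReal.ofReal (r ^ s / C) ≤ μH[s] (Metric.closedBall x r) ∧
      μH[s] (Metric.closedBall x r) ≤ ENNReal.ofReal (C * r ^ s)

/-- `A` contains a ball (closed, of positive radius) up to `ℋ^s`-measure zero. -/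
def EssContainsBall {X : Type*} [MetricSpace X] [MeasurableSpace X] [BorelSpace X]
    (s : ℝ) (A : Set X) : Prop :=
  ∃ (x : X) (r : ℝ), 0 < r ∧ μH[s] (Metric.closedBall x r \ A) = 0

/-- The Dirichlet exponent `d(P)`: the supremum, taken in `[0, ∞]`, of those `d > 0` for which
`F_d` contains a ball up to `ℋ^s`-measure zero (`s` is the regularity exponent of the space). -/
noncomputable def dirichletExponent {X : Type*} [MetricSpace X] [MeasurableSpace X]
    [BorelSpace X] (s : ℝ) (P : ℕ → Set X) : ENNReal :=
  ⨆ (d : ℝ) (_ : 0 < d) (_ : EssContainsBall s (approxSet P d)), ENNReal.ofReal d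

/-- The Dirichlet spectrum of an `s`-Ahlfors–David regular space: the set of all Dirichlet
exponents of choices of abstract rationals. -/
def dirichletSpectrum (X : Type*) [MetricSpace X] [MeasurableSpace X] [BorelSpace X]
    (s : ℝ) : Set ENNReal :=
  {d | ∃ P : ℕ → Set X, IsAbstractRationals P ∧ dirichletExponent s P = d}

end AbstractRationals

/-! A maximal `1/q`-separated set is a `1/q`-net, so `F_1` is everything and every exponent is at
least 1. Level `q` has at most `q + 1` points, so the levels from `2^k` to `2^(k+1)` carry `O(4^k)`
points; Borel–Cantelli (`hausdorffMeasure_approxSet_eq_zero`) bounds the exponent by 2.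

For `d` in `[1, 2]`, the grid of mesh about `2^(-kd)` is cut into translates of a progression of
step `2^(-k)`. Each translate is separated enough to extend to a level of block `k`, and `d ≤ 2`
leaves room for all of them. The other levels share one grid, so the block has `O(2^(kd))` points
(`exists_isAbstractRationals_coversGrids`). Covering the grids gives exponent at least `d`; the
point count gives exponent at most `d` and `dim F_t ≤ d/t`.

For `dim F_t ≥ d/t`, binary digits are set to 0 on sparse windows from about `kd` to `kt`. Such
points are `2^(-kt)`-close to the grid infinitely often. The free positions have density at least
any given `s < d/t`, and deleting the forced zeros is an `s`-Hölder map onto `[0, 1]`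
(`le_dimH_range_spreadDigits`). -/

/-! ### Binary digits and sets with prescribed zeros -/

/-- The integer part of `2 ^ m` times the number with binary digits `w`, for the digits before
position `m`. -/
def binaryPrefix (w : ℕ → Fin 2) : ℕ → ℤ
  | 0 => 0
  | m + 1 => 2 * binaryPrefix w m + (w m : ℕ)

lemma sum_ofDigitsTerm_eq_binaryPrefix (w : ℕ → Fin 2) (m : ℕ) :
    ∑ i ∈ Finset.range m, Real.ofDigitsTerm w i = (binaryPrefix w m : ℝ) * ((2 : ℝ) ^ m)⁻¹ := by
  induction m with
  | zero => simp [binaryPrefix]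
  | succ m ih =>
    rw [Finset.sum_range_succ, ih, Real.ofDigitsTerm, binaryPrefix]
    push_cast
    field_simp
    ring

lemma ofDigits_eq_binaryPrefix_add (w : ℕ → Fin 2) (m : ℕ) :
    Real.ofDigits w =
      (binaryPrefix w m + Real.ofDigits fun i ↦ w (i + m)) * ((2 : ℝ) ^ m)⁻¹ := by
  rw [Real.ofDigits_eq_sum_add_ofDigits w m, sum_ofDigitsTerm_eq_binaryPrefix]
  push_cast
  ring

lemma abs_binaryPrefix_sub_le (v w : ℕ → Fin 2) (m : ℕ) :
    |(binaryPrefix v m - binaryPrefix w m : ℝ)| ≤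
      2 ^ m * |Real.ofDigits v - Real.ofDigits w| + 1 := by
  have hv := ofDigits_eq_binaryPrefix_add v m
  have hw := ofDigits_eq_binaryPrefix_add w m
  have h0 := Real.ofDigits_nonneg fun i ↦ v (i + m)
  have h1 := Real.ofDigits_le_one fun i ↦ v (i + m)
  have h2 := Real.ofDigits_nonneg fun i ↦ w (i + m)
  have h3 := Real.ofDigits_le_one fun i ↦ w (i + m)
  have h : (2 : ℝ) ^ m * |Real.ofDigits v - Real.ofDigits w| =
      |(binaryPrefix v m + Real.ofDigits fun i ↦ v (i + m)) -
        (binaryPrefix w m + Real.ofDigits fun i ↦ w (i + m))| := by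
    rw [hv, hw, ← sub_mul, abs_mul, abs_of_pos (by positivity : (0 : ℝ) < ((2 : ℝ) ^ m)⁻¹)]
    field_simp
  rw [h]
  rcases abs_cases (((binaryPrefix v m : ℝ) + Real.ofDigits fun i ↦ v (i + m)) -
        (binaryPrefix w m + Real.ofDigits fun i ↦ w (i + m))) with h | h <;>
  rw [abs_le] <;> constructor <;> linarith

lemma abs_ofDigits_sub_le (v w : ℕ → Fin 2) (m : ℕ) :
    |Real.ofDigits v - Real.ofDigits w| ≤
      (|(binaryPrefix v m - binaryPrefix w m : ℝ)| + 1) * ((2 : ℝ) ^ m)⁻¹ := by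
  have h0 := Real.ofDigits_nonneg fun i ↦ v (i + m)
  have h1 := Real.ofDigits_le_one fun i ↦ v (i + m)
  have h2 := Real.ofDigits_nonneg fun i ↦ w (i + m)
  have h3 := Real.ofDigits_le_one fun i ↦ w (i + m)
  rw [ofDigits_eq_binaryPrefix_add v m, ofDigits_eq_binaryPrefix_add w m, ← sub_mul, abs_mul,
    abs_of_pos (by positivity : (0 : ℝ) < ((2 : ℝ) ^ m)⁻¹)]
  gcongr
  rcases abs_cases ((binaryPrefix v m - binaryPrefix w m : ℝ)) with h | h <;>
  rw [abs_le] <;> constructor <;> linarith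

/-- Spread the digits `w` over the positions satisfying `p`, with the digit `0` elsewhere. -/
def spreadDigits (p : ℕ → Prop) [DecidablePred p] (w : ℕ → Fin 2) (i : ℕ) : Fin 2 :=
  if p i then w (Nat.count p i) else 0

/-- Inserting common zeros doubles the gap `A` and leaves `B` alone; a free digit sends both to
twice themselves plus the same number in `{-1, 0, 1}`. The signs belong to the invariant: `|B| ≤
|A|` alone does not survive the second move. -/
lemma binaryPrefix_sub_spreadDigits (p : ℕ → Prop) [DecidablePred p] (v w : ℕ → Fin 2) (m : ℕ)
    (B A : ℤ)
    (hB : B = binaryPrefix v (Nat.count p m) - binaryPrefix w (Nat.count p m))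
    (hA : A = binaryPrefix (spreadDigits p v) m - binaryPrefix (spreadDigits p w) m) :
    (0 < B ∧ B ≤ A) ∨ (B = 0 ∧ A = 0) ∨ (B < 0 ∧ A ≤ B) := by
  induction m generalizing A B with
  | zero => simp [binaryPrefix] at hA hB; omega
  | succ m ih =>
    have := ih _ _ rfl rfl
    by_cases hp : p m
    · simp only [Nat.count_succ, hp, if_true, binaryPrefix, spreadDigits] at hA hB
      have := (v (Nat.count p m)).isLt
      have := (w (Nat.count p m)).isLt
      omega
    · simp only [Nat.count_succ, hp, if_false, add_zero, binaryPrefix, spreadDigits] at hA hB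
      simp at hA
      omega

lemma abs_ofDigits_sub_le_of_spreadDigits (p : ℕ → Prop) [DecidablePred p] (v w : ℕ → Fin 2)
    (m : ℕ) (h : |Real.ofDigits (spreadDigits p v) - Real.ofDigits (spreadDigits p w)| ≤
      ((2 : ℝ) ^ m)⁻¹) :
    |Real.ofDigits v - Real.ofDigits w| ≤ 3 * ((2 : ℝ) ^ Nat.count p m)⁻¹ := by
  have h1 := abs_ofDigits_sub_le v w (Nat.count p m)
  have h2 := abs_binaryPrefix_sub_le (spreadDigits p v) (spreadDigits p w) m
  have h3 : |(binaryPrefix v (Nat.count p m) - binaryPrefix w (Nat.count p m) : ℝ)| ≤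
      |(binaryPrefix (spreadDigits p v) m - binaryPrefix (spreadDigits p w) m : ℝ)| := by
    exact_mod_cast (by
      have := binaryPrefix_sub_spreadDigits p v w m _ _ rfl rfl
      grind :
      |binaryPrefix v (Nat.count p m) - binaryPrefix w (Nat.count p m)| ≤
      |binaryPrefix (spreadDigits p v) m - binaryPrefix (spreadDigits p w) m|)
  refine h1.trans ?_
  gcongr
  -- The spread prefixes differ by at most `1 + 1`; the tails of `v` and `w` add one more, whence
  -- the factor 3.
  have : (2 : ℝ) ^ m * ((2 : ℝ) ^ m)⁻¹ = 1 := by field_simp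
  have := mul_le_mul_of_nonneg_left h (by positivity : (0 : ℝ) ≤ 2 ^ m)
  linarith

lemma exists_two_pow_inv_bracket {x : ℝ} (h0 : 0 < x) (h1 : x ≤ 1) :
    ∃ m : ℕ, ((2 : ℝ) ^ (m + 1))⁻¹ < x ∧ x ≤ ((2 : ℝ) ^ m)⁻¹ := by
  obtain ⟨m, h2, h3⟩ := exists_nat_pow_near_of_lt_one h0 h1 (by norm_num : (0 : ℝ) < 1 / 2)
    (by norm_num)
  exact ⟨m, by simpa using h2, by simpa using h3⟩

lemma abs_ofDigits_sub_le_rpow {p : ℕ → Prop} [DecidablePred p] {s : ℝ} (hs : 0 < s)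
    (hp : ∀ m : ℕ, s * m ≤ Nat.count p m) (v w : ℕ → Fin 2) :
    |Real.ofDigits v - Real.ofDigits w| ≤ 3 * 2 ^ s *
      |Real.ofDigits (spreadDigits p v) - Real.ofDigits (spreadDigits p w)| ^ s := by
  set u := |Real.ofDigits (spreadDigits p v) - Real.ofDigits (spreadDigits p w)| with hu
  have key : ∀ m : ℕ, u ≤ ((2 : ℝ) ^ m)⁻¹ →
      |Real.ofDigits v - Real.ofDigits w| ≤ 3 * (2 : ℝ) ^ (-(s * m)) := by
    intro m hm
    refine (abs_ofDigits_sub_le_of_spreadDigits p v w m hm).trans ?_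
    rw [← Real.rpow_natCast, ← Real.rpow_neg (by norm_num)]
    gcongr
    · norm_num
    · exact hp m
  rcases (by positivity : 0 ≤ u).eq_or_lt with h0 | h0
  -- When `u = 0` the bound `key` holds for every `m`, so the left side vanishes in the limit.
  · rw [← h0, Real.zero_rpow hs.ne', mul_zero]
    have : Filter.Tendsto (fun m : ℕ ↦ 3 * ((2 : ℝ) ^ (-s)) ^ m) Filter.atTop (nhds (3 * 0)) :=
      (tendsto_pow_atTop_nhds_zero_of_lt_one (by positivity)
        (Real.rpow_lt_one_of_one_lt_of_neg (by norm_num) (by linarith))).const_mul 3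
    rw [mul_zero] at this
    refine ge_of_tendsto' this fun m ↦ ?_
    rw [← Real.rpow_natCast, ← Real.rpow_mul (by norm_num), neg_mul]
    exact key m (by rw [← h0]; positivity)
  · obtain ⟨m, h2, h3⟩ := exists_two_pow_inv_bracket h0 (by
      rw [hu, abs_le]
      constructor <;>
      linarith [Real.ofDigits_nonneg (spreadDigits p v), Real.ofDigits_le_one (spreadDigits p v),
        Real.ofDigits_nonneg (spreadDigits p w), Real.ofDigits_le_one (spreadDigits p w)])
    refine (key m h3).trans ?_
    have h4 : (2 : ℝ) ^ (-(s * m)) = 2 ^ s * (((2 : ℝ) ^ (m + 1))⁻¹) ^ s := by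
      rw [← Real.rpow_natCast, ← Real.rpow_neg (by norm_num), ← Real.rpow_mul (by norm_num),
        ← Real.rpow_add (by norm_num)]
      congr 1
      push_cast
      ring
    rw [h4, mul_assoc]
    gcongr

/-- The point of the unit interval with given binary digits. -/
noncomputable def binaryPoint (w : ℕ → Fin 2) : Icc (0 : ℝ) 1 :=
  ⟨Real.ofDigits w, Real.ofDigits_nonneg w, Real.ofDigits_le_one w⟩

/-- Prescribing the digit `0` outside a set of positions of lower density at least `s` leaves a set
of dimension at least `s`. -/
theorem le_dimH_range_spreadDigits {p : ℕ → Prop} [DecidablePred p] {s : NNReal} (hs : 0 < s)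
    (hp : ∀ m : ℕ, (s : ℝ) * m ≤ Nat.count p m) :
    (s : ENNReal) ≤ dimH (range fun w ↦ binaryPoint (spreadDigits p w)) := by
  classical
  set g : (ℕ → Fin 2) → Icc (0 : ℝ) 1 := fun w ↦ binaryPoint (spreadDigits p w) with hg
  have hdist : ∀ v w, dist (Real.ofDigits v) (Real.ofDigits w) ≤
      3 * 2 ^ (s : ℝ) * dist (g v) (g w) ^ (s : ℝ) := fun v w ↦
    abs_ofDigits_sub_le_rpow (p := p) (by exact_mod_cast hs) hp v w
  -- Binary expansions are not unique, but `hdist` shows that the value of `f` on the range does not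
  -- depend on the preimage chosen.
  let f : Icc (0 : ℝ) 1 → ℝ := fun x ↦ Real.ofDigits (Function.invFun g x)
  have hf : HolderOnWith (3 * 2 ^ (s : ℝ)) s f (range g) := by
    rintro _ ⟨v, rfl⟩ _ ⟨w, rfl⟩
    have h1 : g (Function.invFun g (g v)) = g v := Function.invFun_eq ⟨v, rfl⟩
    have h2 : g (Function.invFun g (g w)) = g w := Function.invFun_eq ⟨w, rfl⟩
    have := hdist (Function.invFun g (g v)) (Function.invFun g (g w))
    rw [h1, h2] at this
    rw [edist_nndist, edist_nndist, ← ENNReal.coe_rpow_of_nonneg _ s.coe_nonneg]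
    exact_mod_cast this
  have himage : Icc (0 : ℝ) 1 ⊆ f '' range g := by
    intro y hy
    obtain ⟨w, -, rfl⟩ := Real.ofDigits_SurjOn (b := 2) (by norm_num) hy
    refine ⟨g w, ⟨w, rfl⟩, ?_⟩
    have h1 : g (Function.invFun g (g w)) = g w := Function.invFun_eq ⟨w, rfl⟩
    have := hdist (Function.invFun g (g w)) w
    rw [h1, dist_self, Real.zero_rpow (by exact_mod_cast hs.ne'), mul_zero] at this
    exact dist_le_zero.mp this
  have h1 : dimH (Icc (0 : ℝ) 1) = 1 := by
    rw [Real.dimH_of_nonempty_interior (by simp)]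
    simp
  have h2 := (dimH_mono himage).trans (hf.dimH_image_le hs)
  rw [h1, ENNReal.le_div_iff_mul_le (by simp [hs.ne']) (by simp), one_mul] at h2
  exact h2

lemma binaryPrefix_nonneg_lt (w : ℕ → Fin 2) (m : ℕ) :
    0 ≤ binaryPrefix w m ∧ binaryPrefix w m < 2 ^ m := by
  induction m with
  | zero => simp [binaryPrefix]
  | succ m ih =>
    have := (w m).isLt
    rw [binaryPrefix, pow_succ]
    omega

/-- A number whose binary digits vanish from position `a` to position `b` is `2 ^ (-b)`-close to the
grid of mesh `2 ^ (-a)`. -/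
lemma exists_abs_ofDigits_sub_div_le {w : ℕ → Fin 2} {a b : ℕ} (hab : a ≤ b)
    (hw : ∀ i, a ≤ i → i < b → w i = 0) :
    ∃ n : ℕ, n < 2 ^ a ∧ |Real.ofDigits w - n / 2 ^ a| ≤ ((2 : ℝ) ^ b)⁻¹ := by
  obtain ⟨h0, h1⟩ := binaryPrefix_nonneg_lt w a
  lift binaryPrefix w a to ℕ using h0 with n hn
  refine ⟨n, by exact_mod_cast h1, ?_⟩
  have h2 := Real.abs_ofDigits_sub_ofDigits_le (x := fun i ↦ w (i + a)) (y := fun _ ↦ 0)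
    (n := b - a) fun i hi ↦ hw (i + a) (by omega) (by omega)
  have h3 : Real.ofDigits (fun _ ↦ 0 : ℕ → Fin 2) = 0 := by simp [Real.ofDigits, Real.ofDigitsTerm]
  rw [h3, sub_zero] at h2
  rw [ofDigits_eq_binaryPrefix_add w a, ← hn, add_mul, Int.cast_natCast, div_eq_mul_inv,
    add_sub_cancel_left, abs_mul, abs_of_pos (by positivity : (0 : ℝ) < ((2 : ℝ) ^ a)⁻¹)]
  refine (mul_le_mul_of_nonneg_right h2 (by positivity)).trans (le_of_eq ?_)
  rw [← mul_inv, Nat.cast_ofNat, ← pow_add, Nat.sub_add_cancel hab]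

/-! ### Sparse windows of forced zeros -/

open Classical in
/-- There is a set of positions of density at least `s` below every bound which avoids infinitely
many of the windows from `a k` to `b k`, provided that these windows are not too long. -/
lemma exists_density_avoiding_windows {a b : ℕ → ℕ} (ha : Monotone a) (hb : Monotone b) {s : ℝ}
    (hs0 : 0 ≤ s) (hs1 : s ≤ 1) (h : ∀ B : ℕ, ∀ᶠ k in Filter.atTop, B + s * b k ≤ a k) :
    ∃ p : ℕ → Prop, (∀ m : ℕ, s * m ≤ Nat.count p m) ∧
      ∃ᶠ k in Filter.atTop, ∀ i, a k ≤ i → i < b k → ¬ p i := by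
  choose F hF using fun B ↦ Filter.eventually_atTop.mp (h B)
  -- Each window is chosen so late that the free gap before it is at least `s` times its right end.
  -- This gap alone supplies the required count throughout the window.
  let K : ℕ → ℕ := fun n ↦ Nat.rec 0 (fun _ k ↦ max (k + 1) (F (b k))) n
  have hK : ∀ n, K (n + 1) = max (K n + 1) (F (b (K n))) := fun _ ↦ rfl
  have hmono : StrictMono K := strictMono_nat_of_lt_succ fun n ↦ by rw [hK]; omega
  have hgap : ∀ n, b (K n) + s * b (K (n + 1)) ≤ a (K (n + 1)) := fun n ↦
    hF _ _ (by rw [hK]; exact le_max_right _ _)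
  obtain ⟨p, hpdef⟩ : ∃ p : ℕ → Prop,
      ∀ i, p i ↔ ¬ ∃ n, a (K (n + 1)) ≤ i ∧ i < b (K (n + 1)) := ⟨_, fun _ ↦ Iff.rfl⟩
  refine ⟨p, fun m ↦ ?_, Filter.frequently_atTop.mpr fun N ↦ ⟨K (N + 1), ?_, ?_⟩⟩
  · induction m with
    | zero => simp
    | succ m ih =>
      by_cases hm : p m
      · rw [Nat.count_succ, if_pos hm]
        push_cast
        linarith
      · obtain ⟨n, hn1, hn2⟩ := not_not.mp (mt (hpdef m).mpr hm)
        have hfree : ∀ i, b (K n) ≤ i → i < a (K (n + 1)) → p i := by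
          intro i hi1 hi2
          rw [hpdef]
          rintro ⟨j, hj1, hj2⟩
          rcases Nat.lt_or_ge j n with hjn | hjn
          · have := hb (hmono.monotone (show j + 1 ≤ n by omega))
            omega
          · have := ha (hmono.monotone (show n + 1 ≤ j + 1 by omega))
            omega
        have hle : b (K n) ≤ a (K (n + 1)) := by
          have := hgap n
          have : (0 : ℝ) ≤ s * b (K (n + 1)) := by positivity
          exact_mod_cast (by linarith : (b (K n) : ℝ) ≤ a (K (n + 1)))
        have hcount : a (K (n + 1)) - b (K n) ≤ Nat.count p (m + 1) := by
          obtain ⟨c, hc⟩ := Nat.exists_eq_add_of_le hle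
          calc a (K (n + 1)) - b (K n) = c := by omega
            _ = Nat.count (fun i ↦ p (b (K n) + i)) c := by
              symm
              rw [Nat.count_iff_forall]
              exact fun i hi ↦ hfree _ (by omega) (by omega)
            _ ≤ Nat.count p (b (K n) + c) := by rw [Nat.count_add]; omega
            _ ≤ Nat.count p (m + 1) := Nat.count_monotone p (by omega)
        have h1 : ((a (K (n + 1)) : ℝ)) - b (K n) ≤ Nat.count p (m + 1) := by
          rw [← Nat.cast_sub hle]
          exact_mod_cast hcount
        have h2 : ((m + 1 : ℕ) : ℝ) ≤ b (K (n + 1)) := by exact_mod_cast hn2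
        have h3 := mul_le_mul_of_nonneg_left h2 hs0
        linarith [hgap n]
  · exact (Nat.le_succ N).trans hmono.le_apply
  · exact fun i h1 h2 h3 ↦ (hpdef i).mp h3 ⟨N, h1, h2⟩

/-! ### Lower bounds from covered grids -/

/-- Passes to dyadic blocks: `q < 2^(k+1)` makes `2^(-(k+1)t)` at most `q^(-t)`. -/
lemma mem_approxSet_of_frequently {X : Type*} [MetricSpace X] {P : ℕ → Set X} {t : ℝ} (ht : 0 ≤ t)
    {x : X} (h : ∃ᶠ k : ℕ in Filter.atTop, ∃ q < 2 ^ (k + 1), 2 ^ k ≤ q ∧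
      ∃ p ∈ P q, dist x p ≤ (2 : ℝ) ^ (-((k + 1) * t))) : x ∈ approxSet P t := by
  rw [approxSet, mem_iInter]
  intro N
  obtain ⟨k, hk, q, hq1, hq2, p, hp, hd⟩ := Filter.frequently_atTop.mp h N
  have hNq : N < q := lt_of_le_of_lt hk (lt_of_lt_of_le Nat.lt_two_pow_self hq2)
  have hq0 : (0 : ℝ) < q := by exact_mod_cast (Nat.zero_le N).trans_lt hNq
  simp only [mem_iUnion]
  refine ⟨q, hNq, p, hp, Metric.mem_closedBall.mpr (hd.trans ?_)⟩
  rw [Real.rpow_neg (by norm_num), one_div]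
  gcongr
  rw [Real.rpow_mul (by norm_num)]
  gcongr
  have : (q : ℝ) ≤ (2 : ℝ) ^ (k + 1) := by exact_mod_cast hq1.le
  exact_mod_cast this

/-- The exponent `k + ⌊k (d - 1)⌋` of the mesh of the grid at scale `2 ^ k`. -/
noncomputable def meshExponent (d : ℝ) (k : ℕ) : ℕ := k + ⌊k * (d - 1)⌋₊

/-- At every scale `2 ^ k`, the sets `P q` with `2 ^ k ≤ q < 2 ^ (k + 1)` cover the grid of mesh
`2 ^ (-meshExponent d k)`. -/
def CoversGrids (d : ℝ) (P : ℕ → Set (Icc (0 : ℝ) 1)) : Prop :=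
  ∀ k n : ℕ, n < 2 ^ meshExponent d k → ∃ q < 2 ^ (k + 1), 2 ^ k ≤ q ∧
    ∃ p ∈ P q, (p : ℝ) = n / 2 ^ meshExponent d k

lemma meshExponent_mono {d : ℝ} (hd : 1 ≤ d) : Monotone (meshExponent d) := by
  intro i j hij
  unfold meshExponent
  have : (0 : ℝ) ≤ d - 1 := by linarith
  gcongr

lemma meshExponent_le {d : ℝ} (hd : 1 ≤ d) (k : ℕ) : (meshExponent d k : ℝ) ≤ k * d := by
  have := Nat.floor_le (show 0 ≤ k * (d - 1) by
    have : (0 : ℝ) ≤ d - 1 := by linarith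
    positivity)
  unfold meshExponent
  push_cast
  linarith

lemma lt_meshExponent (d : ℝ) (k : ℕ) : k * d - 1 < meshExponent d k := by
  have := Nat.lt_floor_add_one (k * (d - 1))
  unfold meshExponent
  push_cast
  linarith

/-- Zeros from `meshExponent d k` to `⌈(k+1)t⌉` put a point within `2^(-(k+1)t)` of the grid. Since
the ends grow like `kd` and `kt`, the condition `s * t < d` is what lets the windows be avoided with
density `s`. -/
lemma le_dimH_approxSet {d t : ℝ} (hd : 1 ≤ d) (hdt : d ≤ t) {P : ℕ → Set (Icc (0 : ℝ) 1)}
    (hP : CoversGrids d P) {s : NNReal} (hs0 : 0 < s) (hs : s * t < d) :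
    (s : ENNReal) ≤ dimH (approxSet P t) := by
  classical
  have ht0 : 0 < t := by linarith
  have hs1 : (s : ℝ) ≤ 1 := by
    by_contra! h
    nlinarith
  let b : ℕ → ℕ := fun k ↦ ⌈((k : ℝ) + 1) * t⌉₊
  have hb : Monotone b := by
    intro i j hij
    simp only [b]
    gcongr
  have hab : ∀ k, meshExponent d k ≤ b k := by
    intro k
    have h1 := meshExponent_le hd k
    have h2 := Nat.le_ceil (((k : ℝ) + 1) * t)
    have : (meshExponent d k : ℝ) ≤ b k := h1.trans (le_trans (by gcongr; linarith) h2)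
    exact_mod_cast this
  obtain ⟨p, hp, hfreq⟩ := exists_density_avoiding_windows (meshExponent_mono hd) hb s.coe_nonneg
    hs1 fun B ↦ by
      have h1 : Filter.Tendsto (fun k : ℕ ↦ (k : ℝ) * (d - s * t)) Filter.atTop Filter.atTop :=
        tendsto_natCast_atTop_atTop.atTop_mul_const (by linarith)
      filter_upwards [h1.eventually_ge_atTop (B + s * t + s + 1)] with k hk
      have h2 := lt_meshExponent d k
      have h3 := Nat.ceil_lt_add_one (show 0 ≤ ((k : ℝ) + 1) * t by positivity)
      have h4 := mul_le_mul_of_nonneg_left h3.le s.coe_nonneg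
      simp only [b]
      linarith
  refine (le_dimH_range_spreadDigits (p := p) hs0 fun m ↦ by convert hp m).trans (dimH_mono ?_)
  rintro _ ⟨w, rfl⟩
  refine mem_approxSet_of_frequently ht0.le (hfreq.mono fun k hk ↦ ?_)
  obtain ⟨n, hn, hnd⟩ := exists_abs_ofDigits_sub_div_le (w := spreadDigits p w) (hab k)
    fun i h1 h2 ↦ if_neg (hk i h1 h2)
  obtain ⟨q, hq1, hq2, x, hx, hxn⟩ := hP k n hn
  refine ⟨q, hq1, hq2, x, hx, ?_⟩
  rw [Subtype.dist_eq, Real.dist_eq, hxn]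
  refine hnd.trans ?_
  rw [Real.rpow_neg (by norm_num), ← Real.rpow_natCast]
  gcongr
  · norm_num
  · exact Nat.le_ceil _

lemma approxSet_eq_univ {d t : ℝ} (ht : 0 ≤ t) (htd : t < d)
    {P : ℕ → Set (Icc (0 : ℝ) 1)} (hP : CoversGrids d P) : approxSet P t = univ := by
  refine eq_univ_of_forall fun ⟨x, hx0, hx1⟩ ↦ mem_approxSet_of_frequently ht ?_
  have h1 : Filter.Tendsto (fun k : ℕ ↦ (k : ℝ) * (d - t)) Filter.atTop Filter.atTop :=
    tendsto_natCast_atTop_atTop.atTop_mul_const (by linarith)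
  refine ((h1.eventually_ge_atTop (1 + t)).mono fun k hk ↦ ?_).frequently
  obtain ⟨w, -, rfl⟩ := Real.ofDigits_SurjOn (b := 2) (by norm_num) ⟨hx0, hx1⟩
  -- With an empty window this is plain truncation of the expansion at the mesh of the grid.
  obtain ⟨n, hn, hnd⟩ := exists_abs_ofDigits_sub_div_le (w := w) (le_refl (meshExponent d k))
    fun i h1 h2 ↦ absurd h1 (by omega)
  obtain ⟨q, hq1, hq2, x, hx, hxn⟩ := hP k n hn
  refine ⟨q, hq1, hq2, x, hx, ?_⟩
  rw [Subtype.dist_eq, Real.dist_eq, hxn]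
  refine hnd.trans ?_
  rw [Real.rpow_neg (by norm_num), ← Real.rpow_natCast]
  gcongr
  · norm_num
  · linarith [lt_meshExponent d k]

/-! ### Upper bounds by covering -/

/-- At every scale `2 ^ k`, the union of the sets `P q` with `2 ^ k ≤ q < 2 ^ (k + 1)` has at most
`C * 2 ^ (k * d)` points. -/
def HasBlockGrowth {X : Type*} (d C : ℝ) (P : ℕ → Set X) : Prop :=
  ∀ k : ℕ, ∃ E : Finset X, (E.card : ℝ) ≤ C * 2 ^ (k * d) ∧
    ∀ q, 2 ^ k ≤ q → q < 2 ^ (k + 1) → P q ⊆ E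

/-- Block `k` contributes at most `C 2^(kd)` balls of radius `2^(-kt)`, so the `s`-sums are
dominated by a geometric series of ratio `2^(d - ts) < 1`, whose tails vanish. -/
theorem hausdorffMeasure_approxSet_eq_zero {X : Type*} [MetricSpace X] [MeasurableSpace X]
    [BorelSpace X] {P : ℕ → Set X} {d C s t : ℝ} (hP : HasBlockGrowth d C P) (hs : 0 < s)
    (ht : 0 < t) (h : d < t * s) : μH[s] (approxSet P t) = 0 := by
  choose E hE1 hE2 using hP
  have hC : 0 ≤ C := by
    have := (Nat.cast_nonneg _).trans (hE1 0)
    simpa using this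
  set ρ : ℝ := 2 ^ (-t) with hρ
  have hρ0 : 0 < ρ := by positivity
  have hρ1 : ρ < 1 := Real.rpow_lt_one_of_one_lt_of_neg (by norm_num) (by linarith)
  set c : ℝ := 2 ^ (d - t * s) with hc
  have hc0 : 0 < c := by positivity
  have hc1 : c < 1 := Real.rpow_lt_one_of_one_lt_of_neg (by norm_num) (by linarith)
  have hdiam : ∀ (k : ℕ) (p : X), Metric.ediam (Metric.closedBall p (ρ ^ k)) ≤
      ENNReal.ofReal (2 * ρ ^ k) := fun k p ↦ by
    rw [← Metric.closedEBall_ofReal (by positivity), ENNReal.ofReal_mul (by norm_num),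
      ENNReal.ofReal_ofNat]
    exact Metric.ediam_closedEBall_le
  have hlim : Filter.Tendsto (fun n : ℕ ↦ ENNReal.ofReal (2 * ρ ^ n)) Filter.atTop (nhds 0) := by
    have := (tendsto_pow_atTop_nhds_zero_of_lt_one hρ0.le hρ1).const_mul 2
    rw [mul_zero] at this
    simpa using ENNReal.tendsto_ofReal this
  have hsum : ∑' k : ℕ, ENNReal.ofReal (C * 2 ^ s * c ^ k) ≠ ⊤ :=
    ((summable_geometric_of_lt_one hc0.le hc1).mul_left _).tsum_ofReal_ne_top
  refine le_antisymm ((Measure.hausdorffMeasure_le_liminf_tsum s (approxSet P t)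
    (fun n : ℕ ↦ ENNReal.ofReal (2 * ρ ^ n)) hlim
    (fun n (i : Σ k : ℕ, E (k + n)) ↦ Metric.closedBall (i.2 : X) (ρ ^ (i.1 + n)))
    (.of_forall fun n i ↦ (hdiam _ _).trans ?_) (.of_forall fun n ↦ ?_)).trans ?_) bot_le
  · refine ENNReal.ofReal_le_ofReal ?_
    have := pow_le_pow_of_le_one hρ0.le hρ1.le (show n ≤ i.1 + n by omega)
    linarith
  · intro x hx
    have := mem_iInter.mp hx (2 ^ n)
    simp only [mem_iUnion] at this
    obtain ⟨q, hq, p, hp, hxp⟩ := this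
    have hq0 : q ≠ 0 := ((Nat.zero_le _).trans_lt hq).ne'
    have h1 := Nat.pow_log_le_self 2 hq0
    have h2 := Nat.lt_pow_succ_log_self (b := 2) (by norm_num) q
    have h3 : n ≤ Nat.log 2 q := Nat.le_log_of_pow_le (by norm_num) hq.le
    obtain ⟨k, hk⟩ := Nat.exists_eq_add_of_le' h3
    rw [hk] at h1 h2
    refine mem_iUnion.mpr ⟨⟨k, p, hE2 _ q h1 h2 hp⟩, Metric.closedBall_subset_closedBall ?_ hxp⟩
    rw [hρ, ← Real.rpow_natCast, ← Real.rpow_mul (by norm_num), mul_comm, mul_neg,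
      Real.rpow_neg (by norm_num), Real.rpow_mul (by norm_num), Real.rpow_natCast, one_div]
    have : ((2 : ℝ) ^ (k + n)) ≤ q := by exact_mod_cast h1
    gcongr
  · refine le_of_le_of_eq (Filter.liminf_le_liminf (.of_forall fun n ↦ ?_))
      (ENNReal.tendsto_sum_nat_add _ hsum).liminf_eq
    rw [ENNReal.tsum_sigma']
    refine ENNReal.tsum_le_tsum fun k ↦ ?_
    rw [tsum_fintype]
    calc ∑ p : E (k + n), Metric.ediam (Metric.closedBall (p : X) (ρ ^ (k + n))) ^ s
        ≤ ∑ p : E (k + n), ENNReal.ofReal ((2 * ρ ^ (k + n)) ^ s) := by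
          refine Finset.sum_le_sum fun p _ ↦ ?_
          rw [← ENNReal.ofReal_rpow_of_nonneg (by positivity) hs.le]
          exact ENNReal.rpow_le_rpow (hdiam _ _) hs.le
      _ = ENNReal.ofReal ((E (k + n)).card * (2 * ρ ^ (k + n)) ^ s) := by
          rw [ENNReal.ofReal_mul (by positivity), ENNReal.ofReal_natCast]
          simp
      _ ≤ ENNReal.ofReal (C * 2 ^ s * c ^ (k + n)) := by
          refine ENNReal.ofReal_le_ofReal ?_
          have h1 : (2 * ρ ^ (k + n)) ^ s = 2 ^ s * 2 ^ (-((k + n : ℕ) * (t * s))) := by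
            rw [Real.mul_rpow (by norm_num) (pow_nonneg hρ0.le _), hρ, ← Real.rpow_natCast,
              ← Real.rpow_mul (by positivity), ← Real.rpow_mul (by positivity)]
            congr 2
            ring
          have h2 : c ^ (k + n) = 2 ^ ((k + n : ℕ) * d) * 2 ^ (-((k + n : ℕ) * (t * s))) := by
            rw [hc, ← Real.rpow_natCast, ← Real.rpow_mul (by norm_num),
              ← Real.rpow_add (by norm_num)]
            congr 1
            ring
          rw [h1, h2]
          calc _ ≤ C * 2 ^ ((k + n : ℕ) * d) * (2 ^ s * 2 ^ (-((k + n : ℕ) * (t * s)))) := by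
                gcongr
                exact hE1 _
            _ = _ := by ring

lemma dimH_approxSet_le {X : Type*} [MetricSpace X] {P : ℕ → Set X} {d C t : ℝ}
    (hP : HasBlockGrowth d C P) (hd : 0 ≤ d) (ht : 0 < t) :
    dimH (approxSet P t) ≤ ENNReal.ofReal d / ENNReal.ofReal t := by
  borelize X
  rw [← ENNReal.ofReal_div_of_pos ht]
  refine ENNReal.le_of_forall_pos_le_add fun ε hε _ ↦ ?_
  have h : μH[((d / t).toNNReal + ε : NNReal)] (approxSet P t) = 0 := by
    refine hausdorffMeasure_approxSet_eq_zero hP (by positivity) ht ?_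
    push_cast
    rw [Real.coe_toNNReal _ (by positivity), mul_add, mul_div_cancel₀ _ ht.ne']
    have : (0 : ℝ) < t * ε := by positivity
    linarith
  exact dimH_le_of_hausdorffMeasure_ne_top (by rw [h]; simp)

/-! ### Regularity and Dirichlet exponents of the interval -/

lemma hausdorffMeasure_closedBall_unitInterval (x : Icc (0 : ℝ) 1) (r : ℝ) :
    μH[1] (Metric.closedBall x r) =
      ENNReal.ofReal (min (x + r) 1 - max (x - r) 0) := by
  rw [← isometry_subtype_coe.hausdorffMeasure_image (Or.inl zero_le_one), hausdorffMeasure_real]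
  have : (Subtype.val '' Metric.closedBall x r) = Icc (max (x - r : ℝ) 0) (min (x + r) 1) := by
    ext y
    simp only [mem_image, Metric.mem_closedBall, Subtype.dist_eq, Real.dist_eq, abs_le, mem_Icc,
      Subtype.exists, max_le_iff, le_min_iff]
    constructor
    · rintro ⟨y, hy, ⟨h1, h2⟩, rfl⟩
      exact ⟨⟨by linarith, hy.1⟩, by linarith, hy.2⟩
    · rintro ⟨⟨h1, h2⟩, h3, h4⟩
      exact ⟨y, ⟨h2, h4⟩, ⟨by linarith, by linarith⟩, rfl⟩
  rw [this, Real.volume_Icc]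

theorem isAhlforsDavidRegular_unitInterval : IsAhlforsDavidRegular (Icc (0 : ℝ) 1) 1 := by
  -- A ball of radius `r < 1` has length at least `r`, even at an endpoint, and at most `2r`.
  refine ⟨inferInstance, zero_le_one, 2, two_pos, fun x r h0 h1 ↦ ?_⟩
  obtain ⟨hx0, hx1⟩ := x.2
  rw [hausdorffMeasure_closedBall_unitInterval, Real.rpow_one]
  constructor <;> refine ENNReal.ofReal_le_ofReal ?_ <;>
  rcases min_cases ((x : ℝ) + r) 1 with ⟨h, h'⟩ | ⟨h, h'⟩ <;>
  rcases max_cases ((x : ℝ) - r) 0 with ⟨g, g'⟩ | ⟨g, g'⟩ <;>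
  rw [h, g] <;> linarith

lemma hausdorffMeasure_closedBall_ne_zero (x : Icc (0 : ℝ) 1) {r : ℝ} (hr : 0 < r) :
    μH[1] (Metric.closedBall x r) ≠ 0 := by
  obtain ⟨hx0, hx1⟩ := x.2
  rw [hausdorffMeasure_closedBall_unitInterval, Ne, ENNReal.ofReal_eq_zero, not_le, sub_pos,
    max_lt_iff, lt_min_iff, lt_min_iff]
  exact ⟨⟨by linarith, by linarith⟩, by linarith, one_pos⟩

/-- For `t > d` the set `F_t` is null, while balls have positive measure. -/
lemma dirichletExponent_le {P : ℕ → Set (Icc (0 : ℝ) 1)} {d C : ℝ} (hP : HasBlockGrowth d C P) :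
    dirichletExponent 1 P ≤ ENNReal.ofReal d := by
  refine iSup_le fun t ↦ iSup₂_le fun ht ↦ ?_
  rintro ⟨x, r, hr, h⟩
  refine ENNReal.ofReal_le_ofReal (not_lt.mp fun hlt ↦ ?_)
  have h0 := hausdorffMeasure_approxSet_eq_zero hP one_pos ht (by linarith)
  exact hausdorffMeasure_closedBall_ne_zero x hr (by rwa [measure_sdiff_null h0] at h)

lemma le_dirichletExponent_of_approxSet_eq_univ {P : ℕ → Set (Icc (0 : ℝ) 1)} {t : ℝ}
    (ht : 0 < t) (h : approxSet P t = univ) : ENNReal.ofReal t ≤ dirichletExponent 1 P :=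
  le_iSup_of_le t <| le_iSup₂_of_le ht ⟨⟨0, by simp⟩, 1, one_pos, by simp [h]⟩ le_rfl

lemma le_dirichletExponent {P : ℕ → Set (Icc (0 : ℝ) 1)} {d : ℝ} (hP : CoversGrids d P) :
    ENNReal.ofReal d ≤ dirichletExponent 1 P := by
  refine le_of_forall_lt fun c hc ↦ ?_
  obtain ⟨e, hce, hed⟩ := exists_between hc
  have he : e ≠ ⊤ := hed.ne_top
  have h0 : 0 < e.toReal := ENNReal.toReal_pos (bot_le.trans_lt hce).ne' he
  have h1 : e.toReal < d := (ENNReal.lt_ofReal_iff_toReal_lt he).mp hed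
  refine hce.trans_le ?_
  rw [← ENNReal.ofReal_toReal he]
  exact le_dirichletExponent_of_approxSet_eq_univ h0 (approxSet_eq_univ h0.le h1 hP)

/-! ### Separated sets and the bounds 1 and 2 -/

/-- A maximal separated set is a net. -/
lemma exists_dist_lt_of_maximal {X : Type*} [MetricSpace X] {δ : ℝ} (hδ : 0 < δ) {S : Set X}
    (hS : Maximal (IsSep δ) S) (x : X) : ∃ p ∈ S, dist x p < δ := by
  by_contra! h
  have h1 : IsSep δ (insert x S) := by
    exact pairwise_insert.mpr ⟨hS.prop, fun p hp _ ↦ ⟨h p hp, dist_comm x p ▸ h p hp⟩⟩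
  have h2 : x ∈ S := hS.le_of_ge h1 (subset_insert x S) (mem_insert x S)
  exact absurd (h x h2) (by simp [hδ])

lemma one_le_dirichletExponent {P : ℕ → Set (Icc (0 : ℝ) 1)} (hP : IsAbstractRationals P) :
    1 ≤ dirichletExponent 1 P := by
  rw [← ENNReal.ofReal_one]
  refine le_dirichletExponent_of_approxSet_eq_univ one_pos (eq_univ_of_forall fun x ↦ ?_)
  refine mem_iInter.mpr fun N ↦ ?_
  have hN : (0 : ℝ) < 1 / (N + 1 : ℕ) := by positivity
  obtain ⟨p, hp, hd⟩ := exists_dist_lt_of_maximal hN (hP (N + 1) (by omega)) x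
  simp only [mem_iUnion]
  exact ⟨N + 1, by omega, p, hp, by simpa using hd.le⟩

/-- A maximal separated set containing a given separated set. -/
lemma exists_maximal_isSep_superset {X : Type*} [MetricSpace X] {δ : ℝ} {S : Set X}
    (hS : IsSep δ S) : ∃ T, S ⊆ T ∧ Maximal (IsSep δ) T := by
  refine zorn_subset_nonempty {T | IsSep δ T} (fun c hc hchain _ ↦ ⟨⋃₀ c, ?_, fun _ ↦
    subset_sUnion_of_mem⟩) S hS
  exact (pairwise_sUnion hchain.directedOn).mpr hc

/-- A `1 / q`-separated subset of the unit interval has at most `q + 1` points. -/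
lemma IsSep.exists_finset {q : ℕ} (hq : 1 ≤ q) {S : Set (Icc (0 : ℝ) 1)}
    (hS : IsSep (1 / (q : ℝ)) S) : ∃ E : Finset (Icc (0 : ℝ) 1), E.card ≤ q + 1 ∧ S ⊆ E := by
  have hq0 : (0 : ℝ) < q := by exact_mod_cast hq
  -- Equal floors would force `|x - y| < 1/q`; the endpoint 1 accounts for the extra value `q`.
  let f : Icc (0 : ℝ) 1 → ℕ := fun x ↦ ⌊q * (x : ℝ)⌋₊
  have hmaps : MapsTo f S (Finset.range (q + 1)) := by
    rintro ⟨x, hx⟩ -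
    have h := Nat.floor_le_of_le (mul_le_of_le_one_right hq0.le hx.2)
    simp only [f, Finset.coe_range, mem_Iio]
    omega
  have hinj : InjOn f S := by
    intro x hx y hy hxy
    by_contra hne
    have h1 : 1 / (q : ℝ) ≤ dist x y := hS hx hy hne
    rw [Subtype.dist_eq, Real.dist_eq, div_le_iff₀ hq0, ← abs_of_pos hq0, ← abs_mul] at h1
    have h2 := Nat.floor_le (show 0 ≤ q * (x : ℝ) by have := x.2.1; positivity)
    have h3 := Nat.floor_le (show 0 ≤ q * (y : ℝ) by have := y.2.1; positivity)
    have h4 := Nat.lt_floor_add_one (q * (x : ℝ))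
    have h5 := Nat.lt_floor_add_one (q * (y : ℝ))
    have h6 : (⌊q * (x : ℝ)⌋₊ : ℝ) = ⌊q * (y : ℝ)⌋₊ := by exact_mod_cast hxy
    have h7 : |((x : ℝ) - y) * q| < 1 := by
      rw [abs_lt]
      constructor <;> linarith
    linarith
  have hfin : S.Finite := (Finset.finite_toSet _).of_injOn hmaps hinj
  refine ⟨hfin.toFinset, ?_, by simp⟩
  rw [← Finset.card_range (q + 1)]
  exact Finset.card_le_card_of_injOn f (by simpa using hmaps) (by simpa using hinj)

lemma dirichletExponent_le_two {P : ℕ → Set (Icc (0 : ℝ) 1)} (hP : IsAbstractRationals P) :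
    dirichletExponent 1 P ≤ 2 := by
  classical
  -- Each of the `2^k` levels of a block has at most `q + 1 ≤ 2^(k+1)` points.
  have h : HasBlockGrowth 2 2 P := by
    intro k
    have h1 : ∀ q, ∃ E : Finset (Icc (0 : ℝ) 1), 1 ≤ q → E.card ≤ q + 1 ∧ P q ⊆ E := fun q ↦ by
      by_cases hq : 1 ≤ q
      · obtain ⟨E, hE⟩ := (hP q hq).prop.exists_finset hq
        exact ⟨E, fun _ ↦ hE⟩
      · exact ⟨∅, fun h ↦ absurd h hq⟩
    choose E hE using h1
    have hpos := Nat.one_le_two_pow (n := k)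
    refine ⟨(Finset.Ico (2 ^ k) (2 ^ (k + 1))).biUnion E, ?_, fun q hq1 hq2 ↦ ?_⟩
    · have h2 : ((Finset.Ico (2 ^ k) (2 ^ (k + 1))).biUnion E).card ≤ 2 ^ k * 2 ^ (k + 1) := by
        refine (Finset.card_biUnion_le_card_mul _ _ (2 ^ (k + 1)) fun q hq ↦ ?_).trans ?_
        · rw [Finset.mem_Ico] at hq
          exact ((hE q (by omega)).1).trans hq.2
        · rw [Nat.card_Ico, pow_succ]
          gcongr
          omega
      have h3 : (2 : ℝ) * 2 ^ (k * (2 : ℝ)) = (2 ^ k * 2 ^ (k + 1) : ℕ) := by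
        rw [Real.rpow_mul (by norm_num), Real.rpow_natCast]
        push_cast
        rw [Real.rpow_two]
        ring
      rw [h3]
      exact_mod_cast h2
    · exact (hE q (by omega)).2.trans fun x hx ↦ by
        simp only [Finset.coe_biUnion, mem_iUnion]
        exact ⟨q, by simp [hq1, hq2], hx⟩
  simpa using dirichletExponent_le h

/-! ### Rationals with a prescribed exponent -/

/-- The arithmetic progression of step `2 ^ (-k)` and length `n` in `[0, 1]` starting at `u`. -/
def shiftedGrid (k n : ℕ) (u : ℝ) : Set (Icc (0 : ℝ) 1) :=
  {x | ∃ j < n, (x : ℝ) = j / 2 ^ k + u}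

lemma isSep_shiftedGrid (k n : ℕ) (u : ℝ) {δ : ℝ} (hδ : δ ≤ ((2 : ℝ) ^ k)⁻¹) :
    IsSep δ (shiftedGrid k n u) := by
  rintro x ⟨i, -, hi⟩ y ⟨j, -, hj⟩ hxy
  have hij : i ≠ j := fun h ↦ hxy (Subtype.ext (by rw [hi, hj, h]))
  have h1 : (1 : ℝ) ≤ |(i : ℝ) - j| := by
    exact_mod_cast Int.one_le_abs (sub_ne_zero.mpr (by exact_mod_cast hij : (i : ℤ) ≠ j))
  refine hδ.trans ?_
  rw [Subtype.dist_eq, Real.dist_eq, hi, hj, add_sub_add_right_eq_sub, ← sub_div, abs_div,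
    abs_of_pos (by positivity : (0 : ℝ) < 2 ^ k), inv_eq_one_div]
  gcongr

/-- Every point is within half a mesh, `2^(-(k+1)) < 1/q`, of the grid. Thus one grid serves all
levels of the block, and repeated levels add no points. -/
lemma maximal_isSep_shiftedGrid {k q : ℕ} (hq1 : 2 ^ k ≤ q) (hq2 : q < 2 ^ (k + 1)) :
    Maximal (IsSep (1 / (q : ℝ))) (shiftedGrid k (2 ^ k + 1) 0) := by
  have h1 : (2 : ℝ) ^ k ≤ q := by exact_mod_cast hq1
  have h2 : (q : ℝ) < 2 ^ (k + 1) := by exact_mod_cast hq2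
  have hk : (0 : ℝ) < 2 ^ k := by positivity
  refine ⟨isSep_shiftedGrid _ _ _ (by rw [one_div]; gcongr), fun T hT hle x hx ↦ ?_⟩
  obtain ⟨hx0, hx1⟩ := x.2
  have hy0 : 0 ≤ (2 : ℝ) ^ k * x + 1 / 2 := by positivity
  have hj : ⌊(2 : ℝ) ^ k * x + 1 / 2⌋₊ < 2 ^ k + 1 := by
    rw [Nat.floor_lt hy0]
    push_cast
    nlinarith
  have hj1 := Nat.floor_le hy0
  have hj2 := Nat.lt_floor_add_one ((2 : ℝ) ^ k * x + 1 / 2)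
  set j := ⌊(2 : ℝ) ^ k * x + 1 / 2⌋₊
  have hjle : (j : ℝ) ≤ 2 ^ k := by exact_mod_cast Nat.lt_succ_iff.mp hj
  let p : Icc (0 : ℝ) 1 := ⟨j / 2 ^ k, by positivity, (div_le_one hk).mpr hjle⟩
  have hp : p ∈ shiftedGrid k (2 ^ k + 1) 0 := ⟨j, hj, by simp [p]⟩
  by_contra hne
  have h3 : 1 / (q : ℝ) ≤ dist x p := hT hx (hle hp) fun h ↦ hne (h ▸ hp)
  have h4 : dist x p ≤ (1 / 2) / 2 ^ k := by
    rw [Subtype.dist_eq, Real.dist_eq, le_div_iff₀ hk, ← abs_of_pos hk, ← abs_mul,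
      sub_mul, div_mul_cancel₀ _ hk.ne', abs_le]
    constructor <;> linarith
  have h5 : (1 / 2) / 2 ^ k < 1 / (q : ℝ) := by
    rw [div_div, ← pow_succ']
    exact one_div_lt_one_div_of_lt (hk.trans_le h1) h2
  linarith

lemma card_le_of_shiftedGrid (k n : ℕ) (u : ℝ) :
    ∃ E : Finset (Icc (0 : ℝ) 1), E.card ≤ n ∧ shiftedGrid k n u ⊆ E := by
  classical
  refine ⟨(Finset.range n).image fun j : ℕ ↦ projIcc 0 1 zero_le_one ((j : ℝ) / 2 ^ k + u),
    Finset.card_image_le.trans (Finset.card_range n).le, ?_⟩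
  rintro x ⟨j, hj, hx⟩
  simp only [Finset.coe_image, mem_image, Finset.coe_range, mem_Iio]
  exact ⟨j, hj, by rw [← hx, projIcc_val]⟩

/-- For every `d` in `[1, 2]` there are abstract rationals whose blocks contain a grid with about
`2 ^ (k * d)` points and not many more points. -/
theorem exists_isAbstractRationals_coversGrids {d : ℝ} (hd1 : 1 ≤ d) (hd2 : d ≤ 2) :
    ∃ P : ℕ → Set (Icc (0 : ℝ) 1), IsAbstractRationals P ∧ CoversGrids d P ∧
      HasBlockGrowth d 4 P := by
  classical
  have hex : ∀ k i : ℕ, i < 2 ^ k → ∃ T : Set (Icc (0 : ℝ) 1),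
      Maximal (IsSep (1 / ((2 ^ k + i : ℕ) : ℝ))) T ∧
      if i < 2 ^ ⌊k * (d - 1)⌋₊ then shiftedGrid k (2 ^ k) (i / 2 ^ meshExponent d k) ⊆ T
      else T = shiftedGrid k (2 ^ k + 1) 0 := by
    intro k i hi
    split_ifs with h
    · obtain ⟨T, hT1, hT2⟩ := exists_maximal_isSep_superset
        (isSep_shiftedGrid k (2 ^ k) (i / 2 ^ meshExponent d k)
          (δ := 1 / ((2 ^ k + i : ℕ) : ℝ)) (by
            rw [one_div]
            gcongr
            push_cast
            linarith [(Nat.cast_nonneg i : (0 : ℝ) ≤ i)]))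
      exact ⟨T, hT2, hT1⟩
    · exact ⟨_, maximal_isSep_shiftedGrid (by omega) (by rw [pow_succ]; omega), rfl⟩
  choose! T hTmax hT using hex
  have hblock : ∀ q k, 2 ^ k ≤ q → q < 2 ^ (k + 1) → Nat.log 2 q = k := fun q k h1 h2 ↦
    Nat.log_eq_of_pow_le_of_lt_pow h1 h2
  let P : ℕ → Set (Icc (0 : ℝ) 1) := fun q ↦ T (Nat.log 2 q) (q - 2 ^ Nat.log 2 q)
  have hPmax : IsAbstractRationals P := by
    intro q hq
    have h1 := Nat.pow_log_le_self 2 (show q ≠ 0 by omega)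
    have h2 := Nat.lt_pow_succ_log_self (b := 2) (by norm_num) q
    rw [pow_succ] at h2
    have h3 := hTmax (Nat.log 2 q) (q - 2 ^ Nat.log 2 q) (by omega)
    rwa [Nat.add_sub_cancel' h1] at h3
  have hcle : ∀ k : ℕ, ⌊k * (d - 1)⌋₊ ≤ k := fun k ↦ by
    refine Nat.floor_le_of_le (mul_le_of_le_one_right (by positivity) (by linarith))
  refine ⟨P, hPmax, fun k n hn ↦ ?_, fun k ↦ ?_⟩
  -- The remainder of `n` modulo `2^c` selects the level, and the quotient the place in its
  -- progression, as `2^c` fine steps make one step `2^(-k)`.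
  · set c := ⌊k * (d - 1)⌋₊ with hc
    have hmesh : meshExponent d k = k + c := rfl
    have hi : n % 2 ^ c < 2 ^ c := Nat.mod_lt _ (by positivity)
    have hik : n % 2 ^ c < 2 ^ k := hi.trans_le (Nat.pow_le_pow_right (by norm_num) (hcle k))
    have hj : n / 2 ^ c < 2 ^ k := by
      rw [hmesh, pow_add] at hn
      exact (Nat.div_lt_iff_lt_mul (by positivity)).mpr hn
    have hq : 2 ^ k + n % 2 ^ c < 2 ^ (k + 1) := by rw [pow_succ]; omega
    refine ⟨2 ^ k + n % 2 ^ c, hq, Nat.le_add_right _ _, ⟨n / 2 ^ meshExponent d k, by positivity,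
      (div_le_one (by positivity)).mpr (by exact_mod_cast hn.le)⟩, ?_, rfl⟩
    have h1 := hT k (n % 2 ^ c) hik
    rw [if_pos hi] at h1
    simp only [P]
    rw [hblock _ k (Nat.le_add_right _ _) hq, Nat.add_sub_cancel_left]
    refine h1 ⟨n / 2 ^ c, hj, ?_⟩
    have h2 : (n : ℝ) = 2 ^ c * (n / 2 ^ c : ℕ) + (n % 2 ^ c : ℕ) := by
      exact_mod_cast (Nat.div_add_mod n (2 ^ c)).symm
    change (n : ℝ) / 2 ^ meshExponent d k = _
    rw [hmesh, pow_add]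
    nth_rewrite 1 [h2]
    field_simp
  · set c := ⌊k * (d - 1)⌋₊ with hc
    have hpos := Nat.one_le_two_pow (n := k)
    have h1 : ∀ i, ∃ E : Finset (Icc (0 : ℝ) 1), i < 2 ^ k → E.card ≤ 2 ^ (k + 1) ∧ T k i ⊆ E := by
      intro i
      by_cases hi : i < 2 ^ k
      · obtain ⟨E, hE1, hE2⟩ := (hTmax k i hi).prop.exists_finset (by omega)
        exact ⟨E, fun _ ↦ ⟨by rw [pow_succ]; omega, hE2⟩⟩
      · exact ⟨∅, fun h ↦ absurd h hi⟩
    choose E hE using h1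
    obtain ⟨D, hD1, hD2⟩ := card_le_of_shiftedGrid k (2 ^ k + 1) 0
    have hck : 2 ^ c ≤ 2 ^ k := Nat.pow_le_pow_right (by norm_num) (hcle k)
    refine ⟨(Finset.range (2 ^ c)).biUnion E ∪ D, ?_, fun q hq1 hq2 ↦ ?_⟩
    -- The `2^c` special levels give at most `2 * 2^(k+c)` points, and the shared grid `2^k + 1 ≤ 2
    -- * 2^(k+c)`.
    · have h2 : ((Finset.range (2 ^ c)).biUnion E ∪ D).card ≤ 4 * 2 ^ (k + c) := by
        refine (Finset.card_union_le _ _).trans ?_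
        have h3 := Finset.card_biUnion_le_card_mul (Finset.range (2 ^ c)) E (2 ^ (k + 1))
          fun i hi ↦ (hE i ((Finset.mem_range.mp hi).trans_le hck)).1
        rw [Finset.card_range] at h3
        have h4 : 2 ^ k ≤ 2 ^ (k + c) := Nat.pow_le_pow_right (by norm_num) (by omega)
        have h5 : 2 ^ c * 2 ^ (k + 1) = 2 * 2 ^ (k + c) := by ring
        omega
      calc _ ≤ ((4 * 2 ^ (k + c) : ℕ) : ℝ) := by exact_mod_cast h2
        _ = 4 * (2 : ℝ) ^ ((meshExponent d k : ℕ) : ℝ) := by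
          rw [Real.rpow_natCast, meshExponent]
          push_cast
          rfl
        _ ≤ _ := by
          gcongr
          · norm_num
          · exact meshExponent_le hd1 k
    · simp only [P]
      rw [hblock q k hq1 hq2]
      have hi : q - 2 ^ k < 2 ^ k := by rw [pow_succ] at hq2; omega
      by_cases h : q - 2 ^ k < 2 ^ c
      · refine (hE _ hi).2.trans fun x hx ↦ ?_
        rw [Finset.coe_union, Finset.coe_biUnion]
        exact Or.inl (mem_biUnion (by simpa using h) hx)
      · have h2 := hT k _ hi
        rw [if_neg h] at h2
        rw [h2, Finset.coe_union]
        exact hD2.trans subset_union_right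

/-! ### Conclusion -/

theorem exists_isAbstractRationals_dimH {d : ℝ} (hd1 : 1 ≤ d) (hd2 : d ≤ 2) :
    ∃ P : ℕ → Set (Icc (0 : ℝ) 1), IsAbstractRationals P ∧
      dirichletExponent 1 P = ENNReal.ofReal d ∧
      ∀ t : ℝ, d ≤ t → dimH (approxSet P t) = ENNReal.ofReal d / ENNReal.ofReal t := by
  obtain ⟨P, h1, h2, h3⟩ := exists_isAbstractRationals_coversGrids hd1 hd2
  refine ⟨P, h1, (dirichletExponent_le h3).antisymm (le_dirichletExponent h2), fun t hdt ↦ ?_⟩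
  have ht : 0 < t := by linarith
  refine (dimH_approxSet_le h3 (by linarith) ht).antisymm ?_
  refine ENNReal.le_of_forall_nnreal_lt fun s hs ↦ ?_
  rcases (bot_le : 0 ≤ s).eq_or_lt with rfl | hs0
  · simp
  · refine le_dimH_approxSet hd1 hdt h2 hs0 ?_
    rw [← ENNReal.ofReal_div_of_pos ht, ← ENNReal.ofReal_coe_nnreal,
      ENNReal.ofReal_lt_ofReal_iff (by positivity)] at hs
    exact (lt_div_iff₀ ht).mp hs

theorem mainTheorem4 :
    IsAhlforsDavidRegular (Set.Icc (0 : ℝ) 1) 1 ∧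
    dirichletSpectrum (Set.Icc (0 : ℝ) 1) 1 = Set.Icc (1 : ENNReal) 2 ∧
    ∀ d ∈ dirichletSpectrum (Set.Icc (0 : ℝ) 1) 1,
      ∃ P : ℕ → Set (Set.Icc (0 : ℝ) 1),
        IsAbstractRationals P ∧ dirichletExponent 1 P = d ∧
          ∀ t : ℝ, d ≤ ENNReal.ofReal t →
            dimH (approxSet P t) = d / ENNReal.ofReal t := by
  have hsub : dirichletSpectrum (Icc (0 : ℝ) 1) 1 ⊆ Icc (1 : ENNReal) 2 := by
    rintro _ ⟨P, hP, rfl⟩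
    exact ⟨one_le_dirichletExponent hP, dirichletExponent_le_two hP⟩
  have hex : ∀ d ∈ Icc (1 : ENNReal) 2, ∃ P : ℕ → Set (Icc (0 : ℝ) 1),
      IsAbstractRationals P ∧ dirichletExponent 1 P = d ∧
        ∀ t : ℝ, d ≤ ENNReal.ofReal t → dimH (approxSet P t) = d / ENNReal.ofReal t := by
    rintro d ⟨hd1, hd2⟩
    have hd : d ≠ ⊤ := (hd2.trans_lt (by simp)).ne
    lift d to NNReal using hd
    have h1 : (1 : ℝ) ≤ d := by exact_mod_cast hd1
    have h2 : (d : ℝ) ≤ 2 := by exact_mod_cast hd2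
    obtain ⟨P, hP1, hP2, hP3⟩ := exists_isAbstractRationals_dimH h1 h2
    rw [ENNReal.ofReal_coe_nnreal] at hP2 hP3
    refine ⟨P, hP1, hP2, fun t ht ↦ hP3 t ?_⟩
    rw [← ENNReal.ofReal_coe_nnreal] at ht
    -- Truncation in `ENNReal.ofReal` allows the alternative `d ≤ 0`, which `1 ≤ d` excludes.
    exact (ENNReal.ofReal_le_ofReal_iff' .. |>.mp ht).resolve_right (by linarith)
  refine ⟨isAhlforsDavidRegular_unitInterval, hsub.antisymm fun d hd ↦ ?_, fun d hd ↦
    hex d (hsub hd)⟩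
  obtain ⟨P, hP1, hP2, -⟩ := hex d hd
  exact ⟨P, hP1, hP2⟩
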